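/- Let $\mathcal E_1,\dots,\mathcal E_n$ be independent symmetric exponential random variables with variance $1$, i.e. each $\mathcal E_i$ has density $2^{-1/2}\exp(-\sqrt2\,|x|)$ on $\mathbb R$, and let $a=(a_1,\dots,a_n)\in\mathbb R^n$. Then for every real $p\ge 2$, \[ \max\Big\{\gamma_p\|a\|_2,\ \frac{p}{e\sqrt2}\|a\|_\infty\Big\}\ \le\ \Big\|\sum_{i=1}^n a_i\mathcal E_i\Big\|_p\ \le\ \gamma_p\|a\|_2+p\|a\|_\infty, \] where $\|X\|_p=(\mathbf E|X|^p)^{1/p}$ for a random variable $X$, $\|a\|_2=(\sum_{i=1}^n a_i^2)^{1/2}$, $\|a\|_\infty=\max_{i}|a_i|$, and $\gamma_p=(\mathbf E|g|^p)^{1/p}$ is the $p$-th norm of a standard Gaussian variable $g\sim N(0,1)$, i.e. $\gamma_p^p=2^{p/2}\Gamma(\frac{p+1}{2})/\sqrt\pi$. -/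

import Mathlib

open MeasureTheory ProbabilityTheory
open scoped ENNReal

/-- The symmetric exponential law with variance `1`: the measure on `ℝ` with density
`x ↦ 2 ^ (-1/2) * exp (-√2 |x|)` with respect to Lebesgue measure. -/
noncomputable def symmExpMeasure : Measure ℝ :=
  volume.withDensity fun x => ENNReal.ofReal ((√2)⁻¹ * Real.exp (-√2 * |x|))

/-- `γ_p = ‖N(0,1)‖_p`, the `L^p` norm of a standard Gaussian variable. -/
noncomputable def gaussianNorm (p : ℝ) : ℝ :=
  (∫ x, |x| ^ p ∂gaussianReal 0 1) ^ (1 / p)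

/-!
A symmetric exponential variable of variance `1` has characteristic function `(1 + u² / 2)⁻¹`,
which is also that of `√η * g`, where `η` is exponential of parameter `1` and `g` is an independent
standard Gaussian variable. Comparing characteristic functions, `∑ aᵢ ℰᵢ` is therefore distributed
as `√(∑ aᵢ² ηᵢ) * g` with `ηᵢ` i.i.d. exponential, and
`‖∑ aᵢ ℰᵢ‖_p = γ_p * ‖∑ aᵢ² ηᵢ‖_{p/2} ^ (1/2)`.

* Since `ηᵢ` has mean `1`, the norm on the right is at least `∑ aᵢ²`: this is the Gaussian lower
  bound. It is also monotone in each `|aᵢ|`, so `‖∑ aᵢ ℰᵢ‖_p ≥ |aⱼ| ‖ℰⱼ‖_p`, and Markov's inequality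
  at the level `p / √2` bounds `‖ℰⱼ‖_p` from below by `p / (e √2)`.
* The elementary inequality `x ^ q ≤ A ^ q * exp (q (x / A - 1))` turns the exponential moment of
  `∑ aᵢ² ηᵢ` at `q / A`, for `q = p / 2` and `A = ‖a‖₂² + q ‖a‖_∞²`, into
  `‖∑ aᵢ² ηᵢ‖_q ≤ A`. Applied to `g²` it gives `γ_p ≤ √(2 p)`, so that
  `γ_p √A ≤ γ_p ‖a‖₂ + p ‖a‖_∞`.
-/

section Exponential

variable {r : ℝ}

theorem expMeasure_eq_withDensity_Ioi (r : ℝ) :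
    expMeasure r = (volume.restrict (Set.Ioi 0)).withDensity
      fun x => ENNReal.ofReal (r * Real.exp (-(r * x))) := by
  have h : exponentialPDF r = (Set.Ici (0 : ℝ)).indicator
      fun x => ENNReal.ofReal (r * Real.exp (-(r * x))) := by
    ext x
    simp only [exponentialPDF_eq, Set.indicator_apply, Set.mem_Ici, apply_ite ENNReal.ofReal,
      ENNReal.ofReal_zero]
  change volume.withDensity (exponentialPDF r) = _
  rw [h, withDensity_indicator measurableSet_Ici, restrict_Ioi_eq_restrict_Ici]

theorem integral_expMeasure (hr : 0 ≤ r) {E : Type*} [NormedAddCommGroup E] [NormedSpace ℝ E]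
    (f : ℝ → E) :
    ∫ x, f x ∂expMeasure r = ∫ x in Set.Ioi 0, (r * Real.exp (-(r * x))) • f x := by
  rw [expMeasure_eq_withDensity_Ioi,
    integral_withDensity_eq_integral_toReal_smul (by fun_prop) (by simp)]
  simp only [ENNReal.toReal_ofReal (mul_nonneg hr (Real.exp_pos _).le)]

theorem ae_nonneg_expMeasure (r : ℝ) : ∀ᵐ x ∂expMeasure r, 0 ≤ x := by
  rw [expMeasure_eq_withDensity_Ioi]
  filter_upwards [(withDensity_absolutelyContinuous _ _).ae_le
    (ae_restrict_mem measurableSet_Ioi)] with x hx using le_of_lt hx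

theorem integral_id_expMeasure (hr : 0 < r) : ∫ x, x ∂expMeasure r = r⁻¹ := by
  have h := Real.integral_rpow_mul_exp_neg_mul_Ioi two_pos hr
  norm_num at h
  simp only [integral_expMeasure hr.le, smul_eq_mul, mul_assoc, integral_const_mul]
  simp only [mul_comm (Real.exp _), h]
  field_simp

theorem complexMGF_id_expMeasure (hr : 0 < r) {z : ℂ} (hz : z.re < r) :
    complexMGF id (expMeasure r) z = r / (r - z) := by
  have hexp (x : ℝ) : (r * Real.exp (-(r * x))) • Complex.exp (z * x) =
      r * Complex.exp ((z - r) * x) := by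
    rw [Complex.real_smul]
    push_cast
    rw [mul_assoc, ← Complex.exp_add]
    ring_nf
  simp only [complexMGF, id_eq, integral_expMeasure hr.le, hexp]
  rw [integral_const_mul, integral_exp_mul_complex_Ioi (by simpa using hz)]
  simp only [Complex.ofReal_zero, mul_zero, Complex.exp_zero, ← neg_sub (r : ℂ) z, neg_div_neg_eq,
    mul_one_div]

theorem mgf_id_expMeasure (hr : 0 < r) {t : ℝ} (ht : t < r) :
    mgf id (expMeasure r) t = r / (r - t) := by
  have h := complexMGF_id_expMeasure hr (z := t) (by simpa using ht)
  rw [complexMGF_ofReal] at h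
  exact_mod_cast h

theorem charFun_expMeasure (hr : 0 < r) (u : ℝ) :
    charFun (expMeasure r) u = r / (r - u * Complex.I) := by
  rw [← complexMGF_id_mul_I, complexMGF_id_expMeasure hr (by simpa using hr)]

theorem expMeasure_Ioi (hr : 0 < r) {t : ℝ} (ht : 0 ≤ t) :
    expMeasure r (Set.Ioi t) = ENNReal.ofReal (Real.exp (-(r * t))) := by
  have := isProbabilityMeasure_expMeasure hr
  rw [← Set.compl_Iic, ← ofReal_measureReal, probReal_compl_eq_one_sub measurableSet_Iic,
    ← cdf_eq_real, cdf_expMeasure_eq hr, if_pos ht, sub_sub_cancel]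

end Exponential

section SymmetricExponential

theorem symmExpMeasure_eq_smul_add_map_neg :
    symmExpMeasure = (2 : ℝ≥0∞)⁻¹ • (expMeasure √2 + (expMeasure √2).map Neg.neg) := by
  have hmeas : Measurable (exponentialPDF √2) := (measurable_exponentialPDFReal _).ennreal_ofReal
  have hneg : (expMeasure √2).map Neg.neg = volume.withDensity fun x => exponentialPDF √2 (-x) := by
    ext s hs
    rw [Measure.map_apply measurable_neg hs, withDensity_apply _ hs]
    change volume.withDensity (exponentialPDF √2) _ = _
    rw [withDensity_apply _ (measurable_neg hs),
      ← (Measure.measurePreserving_neg (volume : Measure ℝ)).setLIntegral_comp_preimage hs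
        (by fun_prop)]
    simp only [neg_neg]
  rw [hneg]
  change _ = _ • (volume.withDensity (exponentialPDF √2) + _)
  rw [← withDensity_add_left hmeas, ← withDensity_smul _ (by fun_prop), symmExpMeasure]
  refine withDensity_congr_ae ?_
  have hsqrt : (√2)⁻¹ = 2⁻¹ * √2 := by
    field_simp
    norm_num
  filter_upwards [Measure.ae_ne volume 0] with x hx
  simp only [Pi.smul_apply, Pi.add_apply, smul_eq_mul, hsqrt, mul_assoc]
  rw [ENNReal.ofReal_mul (by norm_num), ENNReal.ofReal_inv_of_pos two_pos, ENNReal.ofReal_ofNat]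
  congr 1
  rcases hx.lt_or_gt with hx | hx
  · rw [exponentialPDF_of_neg hx, exponentialPDF_of_nonneg (neg_nonneg.2 hx.le), abs_of_neg hx,
      zero_add, neg_mul]
  · rw [exponentialPDF_of_neg (neg_lt_zero.2 hx), exponentialPDF_of_nonneg hx.le, abs_of_pos hx,
      add_zero, neg_mul]

theorem charFun_symmExpMeasure (u : ℝ) :
    charFun symmExpMeasure u = ((1 + u ^ 2 / 2 : ℝ) : ℂ)⁻¹ := by
  have := isProbabilityMeasure_expMeasure (Real.sqrt_pos.2 two_pos)
  have := Measure.isProbabilityMeasure_map (μ := expMeasure √2) measurable_neg.aemeasurable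
  have hint (μ : Measure ℝ) [IsProbabilityMeasure μ] :
      Integrable (fun x : ℝ => Complex.exp (u * x * Complex.I)) μ := by
    refine Integrable.of_bound (by fun_prop) 1 (.of_forall fun x => ?_)
    rw [← Complex.ofReal_mul, Complex.norm_exp_ofReal_mul_I]
  have hneg : charFun ((expMeasure √2).map Neg.neg) u = charFun (expMeasure √2) (-u) := by
    simp only [charFun_apply_real]
    rw [integral_map (by fun_prop) (by fun_prop)]
    simp only [Complex.ofReal_neg, mul_neg, neg_mul]
  have hadd : charFun symmExpMeasure u =
      2⁻¹ * (charFun (expMeasure √2) u + charFun (expMeasure √2) (-u)) := by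
    rw [← hneg, symmExpMeasure_eq_smul_add_map_neg]
    simp only [charFun_apply_real]
    rw [integral_smul_measure, integral_add_measure (hint _) (hint _), ENNReal.toReal_inv,
      ENNReal.toReal_ofNat, Complex.real_smul, Complex.ofReal_inv, Complex.ofReal_ofNat]
  have hsq : ((√2 : ℝ) : ℂ) ^ 2 = 2 := by exact_mod_cast Real.sq_sqrt zero_le_two
  have hne (v : ℝ) : ((√2 : ℝ) : ℂ) - v * Complex.I ≠ 0 := fun h => by
    simpa using congrArg Complex.re h
  have hmul : ((√2 : ℝ) - u * Complex.I) * ((√2 : ℝ) - (-u : ℝ) * Complex.I) =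
      2 * ((1 + u ^ 2 / 2 : ℝ) : ℂ) := by
    push_cast
    linear_combination hsq - (u : ℂ) ^ 2 * Complex.I_sq
  rw [hadd, charFun_expMeasure (by positivity), charFun_expMeasure (by positivity),
    div_add_div _ _ (hne u) (hne (-u)), hmul]
  have hnum : ((√2 : ℝ) : ℂ) * ((√2 : ℝ) - (-u : ℝ) * Complex.I) +
      ((√2 : ℝ) - u * Complex.I) * (√2 : ℝ) = 4 := by
    push_cast
    linear_combination 2 * hsq
  rw [hnum]
  ring

theorem ofReal_exp_le_symmExpMeasure_abs_ge {t : ℝ} (ht : 0 ≤ t) :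
    ENNReal.ofReal (Real.exp (-(√2 * t))) ≤ symmExpMeasure {x | t ≤ |x|} := by
  have hmeas : MeasurableSet {x : ℝ | t ≤ |x|} := measurableSet_le measurable_const (by fun_prop)
  have hsub : Set.Ioi t ⊆ {x : ℝ | t ≤ |x|} := fun x hx => (le_of_lt hx).trans (le_abs_self x)
  rw [← expMeasure_Ioi (by positivity) ht, symmExpMeasure_eq_smul_add_map_neg]
  simp only [Measure.smul_apply, Measure.add_apply, Measure.map_apply measurable_neg hmeas,
    Set.preimage_ofPred_eq, abs_neg, smul_eq_mul, ← two_mul]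
  rw [ENNReal.inv_mul_cancel_left two_ne_zero ENNReal.ofNat_ne_top]
  exact measure_mono hsub

theorem ofReal_div_le_eLpNorm_id_symmExpMeasure {p : ℝ} (hp : 0 < p) :
    ENNReal.ofReal (p / (Real.exp 1 * √2)) ≤ eLpNorm id (ENNReal.ofReal p) symmExpMeasure := by
  set t := p / √2 with ht
  have ht0 : 0 ≤ t := by positivity
  have hfactor : p / (Real.exp 1 * √2) = t * Real.exp (-1) := by
    rw [ht, Real.exp_neg]
    field_simp
  have htail : Real.exp (-1) ^ p = Real.exp (-(√2 * t)) := by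
    rw [← Real.exp_mul, ht, mul_div_cancel₀ p (by positivity), neg_one_mul]
  have hset : {x : ℝ | ENNReal.ofReal t ≤ ‖id x‖ₑ} = {x | t ≤ |x|} := by
    ext x
    simp only [Set.mem_ofPred_eq, id_eq, Real.enorm_eq_ofReal_abs,
      ENNReal.ofReal_le_ofReal_iff (abs_nonneg x)]
  have hmarkov := mul_meas_ge_le_pow_eLpNorm' symmExpMeasure (p := ENNReal.ofReal p)
    (by simpa using hp) ENNReal.ofReal_ne_top aestronglyMeasurable_id (ENNReal.ofReal t)
  rw [hset, ENNReal.toReal_ofReal hp.le] at hmarkov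
  rw [← ENNReal.rpow_le_rpow_iff hp]
  refine le_trans ?_ hmarkov
  calc ENNReal.ofReal (p / (Real.exp 1 * √2)) ^ p
      = ENNReal.ofReal t ^ p * ENNReal.ofReal (Real.exp (-(√2 * t))) := by
        rw [hfactor, ENNReal.ofReal_mul ht0, ENNReal.mul_rpow_of_nonneg _ _ hp.le, ← htail,
          ENNReal.ofReal_rpow_of_nonneg (Real.exp_pos _).le hp.le]
    _ ≤ ENNReal.ofReal t ^ p * symmExpMeasure {x | t ≤ |x|} := by
        gcongr
        exact ofReal_exp_le_symmExpMeasure_abs_ge ht0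

end SymmetricExponential

section Moments

theorem eLpNorm_mul_prod {α β : Type*} {mα : MeasurableSpace α} {mβ : MeasurableSpace β}
    {μ : Measure α} {ν : Measure β} [SFinite ν] {f : α → ℝ} {g : β → ℝ}
    (hf : AEMeasurable f μ) (hg : AEMeasurable g ν) {p : ℝ≥0∞} (hp : p ≠ 0) (hp_top : p ≠ ∞) :
    eLpNorm (fun z : α × β => f z.1 * g z.2) p (μ.prod ν) = eLpNorm f p μ * eLpNorm g p ν := by
  simp only [eLpNorm_eq_lintegral_rpow_enorm_toReal hp hp_top, enorm_mul,
    ENNReal.mul_rpow_of_nonneg _ _ ENNReal.toReal_nonneg]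
  rw [lintegral_prod_mul (f := fun x => ‖f x‖ₑ ^ p.toReal) (g := fun y => ‖g y‖ₑ ^ p.toReal)
    (by fun_prop) (by fun_prop), ENNReal.mul_rpow_of_nonneg _ _ (by positivity)]

theorem ofReal_integral_le_eLpNorm {Ω : Type*} {_ : MeasurableSpace Ω} {μ : Measure Ω}
    [IsProbabilityMeasure μ] {X : Ω → ℝ} (hX : AEStronglyMeasurable X μ) {p : ℝ≥0∞} (hp : 1 ≤ p) :
    ENNReal.ofReal (∫ ω, X ω ∂μ) ≤ eLpNorm X p μ :=
  calc ENNReal.ofReal (∫ ω, X ω ∂μ) ≤ ‖∫ ω, X ω ∂μ‖ₑ := Real.ofReal_le_enorm _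
    _ ≤ ∫⁻ ω, ‖X ω‖ₑ ∂μ := enorm_integral_le_lintegral_enorm _
    _ = eLpNorm X 1 μ := eLpNorm_one_eq_lintegral_enorm.symm
    _ ≤ eLpNorm X p μ := eLpNorm_le_eLpNorm_of_exponent_le hp hX

theorem rpow_le_rpow_mul_exp {x A q : ℝ} (hx : 0 ≤ x) (hA : 0 < A) (hq : 0 ≤ q) :
    x ^ q ≤ A ^ q * Real.exp (q * (x / A - 1)) := by
  have h : x ≤ A * Real.exp (x / A - 1) := by
    have := Real.add_one_le_exp (x / A - 1)
    rwa [sub_add_cancel, div_le_iff₀' hA] at this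
  calc x ^ q ≤ (A * Real.exp (x / A - 1)) ^ q := Real.rpow_le_rpow hx h hq
    _ = A ^ q * Real.exp (q * (x / A - 1)) := by
      rw [Real.mul_rpow hA.le (Real.exp_pos _).le, ← Real.exp_mul, mul_comm q]

theorem eLpNorm_le_of_mgf_le {Ω : Type*} {_ : MeasurableSpace Ω} {μ : Measure Ω} {X : Ω → ℝ}
    (hX : 0 ≤ᵐ[μ] X) {A q : ℝ} (hA : 0 < A) (hq : 0 < q)
    (hint : Integrable (fun ω => Real.exp (q / A * X ω)) μ)
    (hmgf : mgf X μ (q / A) ≤ Real.exp q) :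
    eLpNorm X (ENNReal.ofReal q) μ ≤ ENNReal.ofReal A := by
  have hpoint : ∀ᵐ ω ∂μ, ‖X ω‖ₑ ^ q ≤
      ENNReal.ofReal (A ^ q * Real.exp (-q) * Real.exp (q / A * X ω)) := by
    filter_upwards [hX] with ω hω
    rw [Real.enorm_eq_ofReal hω, ENNReal.ofReal_rpow_of_nonneg hω hq.le, mul_assoc, ← Real.exp_add]
    refine ENNReal.ofReal_le_ofReal ((rpow_le_rpow_mul_exp hω hA hq.le).trans_eq ?_)
    ring_nf
  rw [eLpNorm_eq_lintegral_rpow_enorm_toReal (by simpa using hq) ENNReal.ofReal_ne_top,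
    ENNReal.toReal_ofReal hq.le, one_div, ENNReal.rpow_inv_le_iff hq]
  calc ∫⁻ ω, ‖X ω‖ₑ ^ q ∂μ
      ≤ ∫⁻ ω, ENNReal.ofReal (A ^ q * Real.exp (-q) * Real.exp (q / A * X ω)) ∂μ :=
        lintegral_mono_ae hpoint
    _ = ENNReal.ofReal (A ^ q * Real.exp (-q) * mgf X μ (q / A)) := by
        rw [← ofReal_integral_eq_lintegral_ofReal (hint.const_mul _)
          (.of_forall fun ω => by positivity), integral_const_mul, mgf]
    _ ≤ ENNReal.ofReal (A ^ q * Real.exp (-q) * Real.exp q) := by gcongr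
    _ = ENNReal.ofReal A ^ q := by
        rw [mul_assoc, ← Real.exp_add, neg_add_cancel, Real.exp_zero, mul_one,
          ENNReal.ofReal_rpow_of_nonneg hA.le hq.le]

end Moments

section GaussianNorm

theorem gaussianNorm_nonneg (p : ℝ) : 0 ≤ gaussianNorm p :=
  Real.rpow_nonneg (integral_nonneg fun _ => Real.rpow_nonneg (abs_nonneg _) _) _

theorem eLpNorm_id_gaussianReal {p : ℝ} (hp : 0 < p) :
    eLpNorm id (ENNReal.ofReal p) (gaussianReal 0 1) = ENNReal.ofReal (gaussianNorm p) := by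
  rw [(memLp_id_gaussianReal' _ ENNReal.ofReal_ne_top).eLpNorm_eq_integral_rpow_norm
    (by simpa using hp) ENNReal.ofReal_ne_top, ENNReal.toReal_ofReal hp.le, gaussianNorm, one_div]
  rfl

theorem mgf_sq_gaussianReal {t : ℝ} (ht : t < 1 / 2) :
    mgf (fun x => x ^ 2) (gaussianReal 0 1) t = (√(1 - 2 * t))⁻¹ := by
  have hdensity (x : ℝ) : gaussianPDFReal 0 1 x • Real.exp (t * x ^ 2) =
      (√(2 * Real.pi))⁻¹ * Real.exp (-(1 / 2 - t) * x ^ 2) := by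
    simp only [gaussianPDFReal, smul_eq_mul, NNReal.coe_one, mul_one, sub_zero]
    rw [mul_assoc, ← Real.exp_add]
    ring_nf
  simp only [mgf, integral_gaussianReal_eq_integral_smul one_ne_zero, hdensity]
  have : 0 < 1 / 2 - t := by linarith
  rw [integral_const_mul, integral_gaussian, ← Real.sqrt_inv, ← Real.sqrt_mul (by positivity),
    ← Real.sqrt_inv]
  congr 1
  field_simp

theorem gaussianNorm_le_sqrt {p : ℝ} (hp : 1 ≤ p) : gaussianNorm p ≤ √(2 * p) := by
  have hp0 : 0 < p := one_pos.trans_le hp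
  have hmgf : mgf (fun x => x ^ 2) (gaussianReal 0 1) (p / 2 / (2 * p)) = √2 := by
    have hquarter : p / 2 / (2 * p) = 1 / 4 := by
      field_simp
      norm_num
    rw [hquarter, mgf_sq_gaussianReal (by norm_num), ← Real.sqrt_inv]
    norm_num
  have hint : Integrable (fun x : ℝ => Real.exp (p / 2 / (2 * p) * x ^ 2)) (gaussianReal 0 1) :=
    not_imp_comm.1 mgf_undef (hmgf.trans_ne (by positivity))
  have hexp : √2 ≤ Real.exp (p / 2) := by
    rw [Real.sqrt_le_left (Real.exp_pos _).le, ← Real.exp_nat_mul]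
    have := Real.add_one_le_exp p
    ring_nf
    linarith
  have hsq : eLpNorm (fun x : ℝ => x ^ 2) (ENNReal.ofReal (p / 2)) (gaussianReal 0 1) =
      ENNReal.ofReal (gaussianNorm p ^ 2) := by
    rw [ENNReal.ofReal_pow (gaussianNorm_nonneg p), ← eLpNorm_id_gaussianReal hp0]
    have := eLpNorm_norm_rpow (μ := gaussianReal 0 1) (p := ENNReal.ofReal (p / 2)) id two_pos
    rw [← ENNReal.ofReal_mul (by positivity), div_mul_cancel₀ _ two_ne_zero] at this
    simpa using this
  refine Real.le_sqrt_of_sq_le ((ENNReal.ofReal_le_ofReal_iff (by positivity)).1 ?_)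
  rw [← hsq]
  exact eLpNorm_le_of_mgf_le (.of_forall sq_nonneg) (by positivity) (by positivity) hint
    (hmgf.trans_le hexp)

theorem gaussianNorm_mul_sqrt_add_le {p : ℝ} (hp : 1 ≤ p) {S M : ℝ} (hS : 0 ≤ S) (hM : 0 ≤ M) :
    gaussianNorm p * √(S + p / 2 * M ^ 2) ≤ gaussianNorm p * √S + p * M := by
  have hp0 : 0 < p := one_pos.trans_le hp
  have hγ := gaussianNorm_nonneg p
  have hsqrt : √(S + p / 2 * M ^ 2) ≤ √S + √(p / 2) * M := by
    refine (Real.sqrt_le_left (by positivity)).2 ?_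
    rw [add_sq, mul_pow, Real.sq_sqrt hS, Real.sq_sqrt (half_pos hp0).le]
    have : 0 ≤ 2 * √S * (√(p / 2) * M) := by positivity
    linarith
  have hγp : gaussianNorm p * √(p / 2) ≤ p :=
    calc gaussianNorm p * √(p / 2) ≤ √(2 * p) * √(p / 2) := by
          gcongr
          exact gaussianNorm_le_sqrt hp
      _ = √(p * p) := by
          rw [← Real.sqrt_mul (by positivity)]
          ring_nf
      _ = p := Real.sqrt_mul_self hp0.le
  calc gaussianNorm p * √(S + p / 2 * M ^ 2) ≤ gaussianNorm p * (√S + √(p / 2) * M) := by gcongr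
    _ = gaussianNorm p * √S + gaussianNorm p * √(p / 2) * M := by ring
    _ ≤ gaussianNorm p * √S + p * M := by gcongr

end GaussianNorm

section ExponentialSum

theorem ae_nonneg_of_hasLaw_expMeasure {ι Ω : Type*} [Countable ι] {_ : MeasurableSpace Ω}
    {P : Measure Ω} {η : ι → Ω → ℝ} {r : ℝ} (hlaw : ∀ i, HasLaw (η i) (expMeasure r) P) :
    ∀ᵐ ω ∂P, ∀ i, 0 ≤ η i ω :=
  ae_all_iff.2 fun i => ((hlaw i).ae_iff (by fun_prop)).2 (ae_nonneg_expMeasure r)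

variable {ι Ω : Type*} [Fintype ι] {mΩ : MeasurableSpace Ω} {P : Measure Ω} {η : ι → Ω → ℝ}
  {b : ι → ℝ} {M q : ℝ}

theorem ae_nonneg_sum_mul_of_hasLaw_expMeasure {r : ℝ} (hlaw : ∀ i, HasLaw (η i) (expMeasure r) P)
    (hb : 0 ≤ b) : 0 ≤ᵐ[P] fun ω => ∑ i, b i * η i ω := by
  filter_upwards [ae_nonneg_of_hasLaw_expMeasure hlaw] with ω hω using
    Finset.sum_nonneg fun i _ => mul_nonneg (hb i) (hω i)

theorem mgf_sum_mul_of_hasLaw_expMeasure {r : ℝ} (hr : 0 < r)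
    (hlaw : ∀ i, HasLaw (η i) (expMeasure r) P) (hindep : iIndepFun η P) {t : ℝ}
    (ht : ∀ i, t * b i < r) :
    mgf (fun ω => ∑ i, b i * η i ω) P t = ∏ i, r / (r - t * b i) := by
  have hm (i) : AEMeasurable (η i) P := (hlaw i).aemeasurable
  have hmgf (i) : mgf (fun ω => b i * η i ω) P t = r / (r - t * b i) := by
    rw [mgf_const_mul, mul_comm, ← mgf_id_map (hm i), (hlaw i).map_eq, mgf_id_expMeasure hr (ht i)]
  have hsum := (hindep.comp (fun i x => b i * x) fun i => measurable_const_mul _).mgf_sum₀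
    (fun i => (hm i).const_mul _) Finset.univ (t := t)
  simp only [Function.comp_def, hmgf] at hsum
  rw [← hsum]
  congr 1
  ext ω
  simp only [Finset.sum_apply]

theorem prod_one_div_one_sub_le_exp {c : ι → ℝ} {s : ℝ} (hs : 0 < s) (hc : 0 ≤ c)
    (hcs : ∀ i, c i ≤ 1 - s) : ∏ i, 1 / (1 - c i) ≤ Real.exp ((∑ i, c i) / s) := by
  have hsc (i) : s ≤ 1 - c i := le_sub_comm.1 (hcs i)
  have hpos (i) : 0 < 1 - c i := hs.trans_le (hsc i)
  rw [Finset.sum_div, Real.exp_sum]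
  refine Finset.prod_le_prod (fun i _ => one_div_nonneg.2 (hpos i).le) fun i _ => ?_
  calc 1 / (1 - c i) = c i / (1 - c i) + 1 := by
        have := (hpos i).ne'
        field_simp
        ring
    _ ≤ c i / s + 1 := by
        gcongr
        exacts [hc i, hsc i]
    _ ≤ Real.exp (c i / s) := Real.add_one_le_exp _

theorem eLpNorm_sum_mul_expMeasure_one_le (hlaw : ∀ i, HasLaw (η i) (expMeasure 1) P)
    (hindep : iIndepFun η P) (hb : 0 ≤ b) (hM : ∀ i, b i ≤ M) (hq : 0 < q) :
    eLpNorm (fun ω => ∑ i, b i * η i ω) (ENNReal.ofReal q) P ≤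
      ENNReal.ofReal (∑ i, b i + q * M) := by
  set S := ∑ i, b i with hS
  rcases (show 0 ≤ S from Finset.sum_nonneg fun i _ => hb i).eq_or_lt with hS0 | hS0
  · have hb0 (i) : b i = 0 :=
      (Finset.sum_eq_zero_iff_of_nonneg fun i _ => hb i).1 hS0.symm i (Finset.mem_univ i)
    simp [hb0]
  obtain ⟨i₀, -, -⟩ := Finset.exists_ne_zero_of_sum_ne_zero hS0.ne'
  have hM0 : 0 ≤ M := (hb i₀).trans (hM i₀)
  set A := S + q * M with hA
  have hA0 : 0 < A := by positivity
  have hc (i) : 0 ≤ q / A * b i := mul_nonneg (by positivity) (hb i)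
  have hcs (i) : q / A * b i ≤ 1 - S / A := by
    rw [one_sub_div hA0.ne', hA, add_sub_cancel_left, div_mul_eq_mul_div]
    gcongr
    exact hM i
  have hlt (i) : q / A * b i < 1 := (hcs i).trans_lt (sub_lt_self 1 (by positivity))
  have hmgf := mgf_sum_mul_of_hasLaw_expMeasure one_pos hlaw hindep hlt
  have hmgf_pos : 0 < ∏ i, 1 / (1 - q / A * b i) :=
    Finset.prod_pos fun i _ => one_div_pos.2 (sub_pos.2 (hlt i))
  refine eLpNorm_le_of_mgf_le (ae_nonneg_sum_mul_of_hasLaw_expMeasure hlaw hb) hA0 hq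
    (not_imp_comm.1 mgf_undef (hmgf.trans_ne hmgf_pos.ne')) ?_
  calc mgf (fun ω => ∑ i, b i * η i ω) P (q / A) = ∏ i, 1 / (1 - q / A * b i) := hmgf
    _ ≤ Real.exp ((∑ i, q / A * b i) / (S / A)) :=
        prod_one_div_one_sub_le_exp (by positivity) hc hcs
    _ = Real.exp q := by
        rw [← Finset.mul_sum, ← hS]
        field_simp

theorem integral_sum_mul_of_hasLaw_expMeasure {r : ℝ} (hr : 0 < r)
    (hlaw : ∀ i, HasLaw (η i) (expMeasure r) P) :
    ∫ ω, ∑ i, b i * η i ω ∂P = (∑ i, b i) / r := by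
  have hmean (i) : ∫ ω, η i ω ∂P = r⁻¹ := (hlaw i).integral_eq.trans (integral_id_expMeasure hr)
  have hint (i) : Integrable (η i) P :=
    not_imp_comm.1 integral_undef ((hmean i).trans_ne (by positivity))
  rw [integral_finsetSum _ fun i _ => (hint i).const_mul _]
  simp only [integral_const_mul, hmean, div_eq_mul_inv, Finset.sum_mul]

end ExponentialSum

section GaussianScaleMixture

variable {Ω : Type*} {mΩ : MeasurableSpace Ω} {ν : Measure Ω} {V : Ω → ℝ}

/-- The law of `√V * g`, where `V` is distributed as under `ν` and `g` is a standard Gaussian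
variable independent of `V`. It is meant for `V ≥ 0`, since `√` vanishes on negative reals. -/
noncomputable def gaussianScaleMixture (ν : Measure Ω) (V : Ω → ℝ) : Measure ℝ :=
  (ν.prod (gaussianReal 0 1)).map fun z => √(V z.1) * z.2

theorem charFun_gaussianScaleMixture [IsFiniteMeasure ν] (hV : AEMeasurable V ν) (hV0 : 0 ≤ᵐ[ν] V)
    (u : ℝ) : charFun (gaussianScaleMixture ν V) u = mgf V ν (-(u ^ 2 / 2)) := by
  have hinner : ∀ᵐ ω ∂ν, ∫ y, Complex.exp (u * (√(V ω) * y : ℝ) * Complex.I) ∂gaussianReal 0 1 =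
      (Real.exp (-(u ^ 2 / 2) * V ω) : ℂ) := by
    filter_upwards [hV0] with ω hω
    have h := charFun_gaussianReal (μ := 0) (v := 1) (u * √(V ω))
    have hsq : ((√(V ω) : ℝ) : ℂ) ^ 2 = V ω := by exact_mod_cast Real.sq_sqrt hω
    rw [charFun_apply_real] at h
    push_cast at h ⊢
    simp only [← mul_assoc, h, mul_pow, hsq]
    ring_nf
  have hint : Integrable (fun z : Ω × ℝ => Complex.exp (u * (√(V z.1) * z.2 : ℝ) * Complex.I))
      (ν.prod (gaussianReal 0 1)) := by
    refine Integrable.of_bound (by fun_prop) 1 (.of_forall fun z => ?_)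
    rw [← Complex.ofReal_mul, Complex.norm_exp_ofReal_mul_I]
  rw [charFun_apply_real, gaussianScaleMixture, integral_map (by fun_prop) (by fun_prop),
    integral_prod _ hint, integral_congr_ae hinner, integral_complex_ofReal, mgf]

theorem eLpNorm_id_gaussianScaleMixture (hV : AEMeasurable V ν) (hV0 : 0 ≤ᵐ[ν] V)
    {p : ℝ} (hp : 0 < p) :
    eLpNorm id (ENNReal.ofReal p) (gaussianScaleMixture ν V) =
      ENNReal.ofReal (gaussianNorm p) * eLpNorm V (ENNReal.ofReal (p / 2)) ν ^ (1 / 2 : ℝ) := by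
  have hsqrt : eLpNorm (fun ω => √(V ω)) (ENNReal.ofReal p) ν =
      eLpNorm V (ENNReal.ofReal (p / 2)) ν ^ (1 / 2 : ℝ) := by
    rw [div_eq_mul_one_div p, ENNReal.ofReal_mul hp.le, ← eLpNorm_norm_rpow V one_half_pos]
    refine eLpNorm_congr_ae ?_
    filter_upwards [hV0] with ω hω
    rw [Real.sqrt_eq_rpow, Real.norm_of_nonneg hω]
  have hprod := eLpNorm_mul_prod (f := fun ω => √(V ω)) (g := id) (μ := ν) (ν := gaussianReal 0 1)
    (by fun_prop) (by fun_prop) (by simpa using hp) (ENNReal.ofReal_ne_top (r := p))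
  rw [gaussianScaleMixture, eLpNorm_map_measure (by fun_prop) (by fun_prop), ← hsqrt,
    ← eLpNorm_id_gaussianReal hp, mul_comm, ← hprod]
  rfl

end GaussianScaleMixture

section SymmetricExponentialSum

variable {ι Ω Ω' : Type*} [Fintype ι] {mΩ : MeasurableSpace Ω} {mΩ' : MeasurableSpace Ω'}
  {P : Measure Ω} {P' : Measure Ω'} {ℰ : ι → Ω → ℝ} {η : ι → Ω' → ℝ} {a b : ι → ℝ} {p : ℝ}

theorem norm_toLp_two_eq_sqrt (a : ι → ℝ) : ‖WithLp.toLp 2 a‖ = √(∑ i, a i ^ 2) := by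
  simp only [EuclideanSpace.norm_eq, Real.norm_eq_abs, sq_abs]

theorem map_sum_mul_eq_gaussianScaleMixture (hlaw : ∀ i, HasLaw (ℰ i) symmExpMeasure P)
    (hindep : iIndepFun ℰ P) (hη : ∀ i, HasLaw (η i) (expMeasure 1) P')
    (hηindep : iIndepFun η P') (a : ι → ℝ) :
    P.map (fun ω => ∑ i, a i * ℰ i ω) =
      gaussianScaleMixture P' fun ω => ∑ i, a i ^ 2 * η i ω := by
  have := hindep.isProbabilityMeasure
  have := hηindep.isProbabilityMeasure
  have hm (i) : AEMeasurable (ℰ i) P := (hlaw i).aemeasurable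
  have hmη (i) : AEMeasurable (η i) P' := (hη i).aemeasurable
  have : IsFiniteMeasure (gaussianScaleMixture P' fun ω => ∑ i, a i ^ 2 * η i ω) := by
    rw [gaussianScaleMixture]; infer_instance
  have hpos (u : ℝ) (i) : -(u ^ 2 / 2) * a i ^ 2 < 1 := by
    nlinarith [sq_nonneg (u * a i)]
  refine Measure.ext_of_charFun (funext fun u => ?_)
  rw [charFun_gaussianScaleMixture (by fun_prop)
      (ae_nonneg_sum_mul_of_hasLaw_expMeasure hη fun i => sq_nonneg (a i)),
    mgf_sum_mul_of_hasLaw_expMeasure one_pos hη hηindep (hpos u),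
    (hindep.comp (fun i x => a i * x) fun i =>
      measurable_const_mul _).charFun_map_fun_sum_eq_prod fun i => (hm i).const_mul _,
    Finset.prod_apply, Complex.ofReal_prod]
  refine Finset.prod_congr rfl fun i _ => ?_
  change charFun (P.map fun ω => a i * ℰ i ω) u = _
  rw [charFun_map_mul_comp (hm i), (hlaw i).map_eq, charFun_symmExpMeasure,
    ← Complex.ofReal_inv, one_div]
  ring_nf

theorem eLpNorm_sum_mul_eq (hlaw : ∀ i, HasLaw (ℰ i) symmExpMeasure P)
    (hindep : iIndepFun ℰ P) (hη : ∀ i, HasLaw (η i) (expMeasure 1) P')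
    (hηindep : iIndepFun η P') (a : ι → ℝ) (hp : 0 < p) :
    eLpNorm (fun ω => ∑ i, a i * ℰ i ω) (ENNReal.ofReal p) P =
      ENNReal.ofReal (gaussianNorm p) *
        eLpNorm (fun ω => ∑ i, a i ^ 2 * η i ω) (ENNReal.ofReal (p / 2)) P' ^ (1 / 2 : ℝ) := by
  have hm (i) : AEMeasurable (ℰ i) P := (hlaw i).aemeasurable
  have hmη (i) : AEMeasurable (η i) P' := (hη i).aemeasurable
  have h := eLpNorm_map_measure (p := ENNReal.ofReal p) (g := id)
    (f := fun ω => ∑ i, a i * ℰ i ω) (μ := P) (by fun_prop) (by fun_prop)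
  rw [← Function.id_comp fun ω => ∑ i, a i * ℰ i ω, ← h,
    map_sum_mul_eq_gaussianScaleMixture hlaw hindep hη hηindep,
    eLpNorm_id_gaussianScaleMixture (by fun_prop)
      (ae_nonneg_sum_mul_of_hasLaw_expMeasure hη fun i => sq_nonneg (a i)) hp]

theorem ofReal_gaussianNorm_mul_norm_le_eLpNorm_sum_mul
    (hlaw : ∀ i, HasLaw (ℰ i) symmExpMeasure P) (hindep : iIndepFun ℰ P) (hp : 2 ≤ p) :
    ENNReal.ofReal (gaussianNorm p * ‖WithLp.toLp 2 a‖) ≤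
      eLpNorm (fun ω => ∑ i, a i * ℰ i ω) (ENNReal.ofReal p) P := by
  have := isProbabilityMeasure_expMeasure one_pos
  obtain ⟨Ω', _, P', η, -, hη, hηindep, _⟩ := exists_iid ι (expMeasure 1)
  have hmη (i) : AEMeasurable (η i) P' := (hη i).aemeasurable
  have hmean := ofReal_integral_le_eLpNorm (X := fun ω => ∑ i, a i ^ 2 * η i ω) (by fun_prop)
    (ENNReal.one_le_ofReal.2 (show 1 ≤ p / 2 by linarith))
  rw [integral_sum_mul_of_hasLaw_expMeasure one_pos hη, div_one] at hmean
  rw [eLpNorm_sum_mul_eq hlaw hindep hη hηindep a (by linarith), norm_toLp_two_eq_sqrt,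
    ENNReal.ofReal_mul (gaussianNorm_nonneg p), Real.sqrt_eq_rpow,
    ← ENNReal.ofReal_rpow_of_nonneg (by positivity) (by positivity)]
  gcongr

theorem eLpNorm_sum_mul_le (hlaw : ∀ i, HasLaw (ℰ i) symmExpMeasure P) (hindep : iIndepFun ℰ P)
    (hp : 1 ≤ p) :
    eLpNorm (fun ω => ∑ i, a i * ℰ i ω) (ENNReal.ofReal p) P ≤
      ENNReal.ofReal (gaussianNorm p * ‖WithLp.toLp 2 a‖ + p * ‖WithLp.toLp ∞ a‖) := by
  have hp0 : 0 < p := one_pos.trans_le hp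
  have := isProbabilityMeasure_expMeasure one_pos
  obtain ⟨Ω', _, P', η, -, hη, hηindep, _⟩ := exists_iid ι (expMeasure 1)
  set M := ‖WithLp.toLp ∞ a‖
  have hM (i) : a i ^ 2 ≤ M ^ 2 := sq_le_sq.2 <|
    (PiLp.norm_apply_le (WithLp.toLp ∞ a) i).trans (le_abs_self M)
  calc eLpNorm (fun ω => ∑ i, a i * ℰ i ω) (ENNReal.ofReal p) P
      = ENNReal.ofReal (gaussianNorm p) *
        eLpNorm (fun ω => ∑ i, a i ^ 2 * η i ω) (ENNReal.ofReal (p / 2)) P' ^ (1 / 2 : ℝ) :=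
        eLpNorm_sum_mul_eq hlaw hindep hη hηindep a hp0
    _ ≤ ENNReal.ofReal (gaussianNorm p) *
        ENNReal.ofReal (∑ i, a i ^ 2 + p / 2 * M ^ 2) ^ (1 / 2 : ℝ) := by
        gcongr
        exact eLpNorm_sum_mul_expMeasure_one_le hη hηindep (fun i => sq_nonneg (a i)) hM
          (half_pos hp0)
    _ = ENNReal.ofReal (gaussianNorm p * √(∑ i, a i ^ 2 + p / 2 * M ^ 2)) := by
        rw [ENNReal.ofReal_mul (gaussianNorm_nonneg p), Real.sqrt_eq_rpow,
          ← ENNReal.ofReal_rpow_of_nonneg (by positivity) (by positivity)]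
    _ ≤ ENNReal.ofReal (gaussianNorm p * ‖WithLp.toLp 2 a‖ + p * M) := by
        rw [norm_toLp_two_eq_sqrt]
        exact ENNReal.ofReal_le_ofReal
          (gaussianNorm_mul_sqrt_add_le hp (by positivity) (norm_nonneg _))

theorem eLpNorm_sum_mul_mono (hlaw : ∀ i, HasLaw (ℰ i) symmExpMeasure P) (hindep : iIndepFun ℰ P)
    (hab : ∀ i, |a i| ≤ |b i|) (hp : 0 < p) :
    eLpNorm (fun ω => ∑ i, a i * ℰ i ω) (ENNReal.ofReal p) P ≤
      eLpNorm (fun ω => ∑ i, b i * ℰ i ω) (ENNReal.ofReal p) P := by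
  have := isProbabilityMeasure_expMeasure one_pos
  obtain ⟨Ω', _, P', η, -, hη, hηindep, _⟩ := exists_iid ι (expMeasure 1)
  rw [eLpNorm_sum_mul_eq hlaw hindep hη hηindep a hp,
    eLpNorm_sum_mul_eq hlaw hindep hη hηindep b hp]
  gcongr _ * ?_ ^ _
  refine eLpNorm_mono_ae_real ?_
  filter_upwards [ae_nonneg_of_hasLaw_expMeasure hη] with ω hω
  rw [Real.norm_of_nonneg (Finset.sum_nonneg fun i _ => mul_nonneg (sq_nonneg _) (hω i))]
  exact Finset.sum_le_sum fun i _ => mul_le_mul_of_nonneg_right (sq_le_sq.2 (hab i)) (hω i)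

theorem ofReal_abs_mul_eLpNorm_le_eLpNorm_sum_mul (hlaw : ∀ i, HasLaw (ℰ i) symmExpMeasure P)
    (hindep : iIndepFun ℰ P) (hp : 0 < p) (j : ι) :
    ENNReal.ofReal |a j| * eLpNorm (ℰ j) (ENNReal.ofReal p) P ≤
      eLpNorm (fun ω => ∑ i, a i * ℰ i ω) (ENNReal.ofReal p) P := by
  classical
  have hsingle : (fun ω => ∑ i, (Pi.single j (a j) : ι → ℝ) i * ℰ i ω) = a j • ℰ j := by
    ext ω
    simp [Pi.single_apply]
  have hle (i) : |(Pi.single j (a j) : ι → ℝ) i| ≤ |a i| := by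
    rcases eq_or_ne i j with rfl | hij
    · simp
    · simp [hij]
  rw [← Real.enorm_eq_ofReal_abs, ← eLpNorm_const_smul, ← hsingle]
  exact eLpNorm_sum_mul_mono hlaw hindep hle hp

theorem ofReal_div_mul_norm_le_eLpNorm_sum_mul (hlaw : ∀ i, HasLaw (ℰ i) symmExpMeasure P)
    (hindep : iIndepFun ℰ P) (hp : 0 < p) :
    ENNReal.ofReal (p / (Real.exp 1 * √2) * ‖WithLp.toLp ∞ a‖) ≤
      eLpNorm (fun ω => ∑ i, a i * ℰ i ω) (ENNReal.ofReal p) P := by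
  rcases isEmpty_or_nonempty ι with _ | _
  · simp [PiLp.norm_eq_ciSup]
  obtain ⟨j, hj⟩ := exists_eq_ciSup_of_finite (f := fun i => ‖a i‖)
  have hsup : ‖WithLp.toLp ∞ a‖ = |a j| := by
    rw [PiLp.norm_eq_ciSup, ← Real.norm_eq_abs]
    exact hj.symm
  rw [hsup, mul_comm, ENNReal.ofReal_mul (abs_nonneg _)]
  refine le_trans ?_ (ofReal_abs_mul_eLpNorm_le_eLpNorm_sum_mul hlaw hindep hp j)
  rw [← Function.id_comp (ℰ j), ← eLpNorm_map_measure (by fun_prop) (hlaw j).aemeasurable,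
    (hlaw j).map_eq]
  gcongr
  exact ofReal_div_le_eLpNorm_id_symmExpMeasure hp

end SymmetricExponentialSum

theorem corollary2_general {ι Ω : Type*} [Fintype ι] [MeasurableSpace Ω] {P : Measure Ω}
    {ℰ : ι → Ω → ℝ} (hlaw : ∀ i, HasLaw (ℰ i) symmExpMeasure P) (hindep : iIndepFun ℰ P)
    (a : ι → ℝ) {p : ℝ} (hp : 2 ≤ p) :
    ENNReal.ofReal
        (max (gaussianNorm p * ‖WithLp.toLp 2 a‖)
          (p / (Real.exp 1 * √2) * ‖WithLp.toLp ∞ a‖))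
      ≤ eLpNorm (fun ω => ∑ i, a i * ℰ i ω) (ENNReal.ofReal p) P ∧
    eLpNorm (fun ω => ∑ i, a i * ℰ i ω) (ENNReal.ofReal p) P
      ≤ ENNReal.ofReal
        (gaussianNorm p * ‖WithLp.toLp 2 a‖ + p * ‖WithLp.toLp ∞ a‖) := by
  rw [ENNReal.ofReal_max]
  exact ⟨max_le (ofReal_gaussianNorm_mul_norm_le_eLpNorm_sum_mul hlaw hindep hp)
      (ofReal_div_mul_norm_le_eLpNorm_sum_mul hlaw hindep (by linarith)),
    eLpNorm_sum_mul_le hlaw hindep (by linarith)⟩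

theorem corollary2 {Ω : Type*} [MeasurableSpace Ω] (P : Measure Ω) [IsProbabilityMeasure P]
    (n : ℕ) (ℰ : Fin n → Ω → ℝ)
    (hlaw : ∀ i, HasLaw (ℰ i) symmExpMeasure P)
    (hindep : iIndepFun ℰ P)
    (a : Fin n → ℝ) (p : ℝ) (hp : 2 ≤ p) :
    ENNReal.ofReal
        (max (gaussianNorm p * ‖WithLp.toLp 2 a‖)
          (p / (Real.exp 1 * √2) * ‖WithLp.toLp ∞ a‖))
      ≤ eLpNorm (fun ω => ∑ i, a i * ℰ i ω) (ENNReal.ofReal p) P ∧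
    eLpNorm (fun ω => ∑ i, a i * ℰ i ω) (ENNReal.ofReal p) P
      ≤ ENNReal.ofReal
        (gaussianNorm p * ‖WithLp.toLp 2 a‖ + p * ‖WithLp.toLp ∞ a‖) :=
  corollary2_general hlaw hindep a hp
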